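/- An \emph{ordered operator space} is a complete operator space $X$ with a (completely isometric) involution and a specified convex cone $M_n(X)_+\subset M_n(X)$ (containing $0$) for each $n$, such that for some Hilbert space $H$ there is a $*$-linear complete isometry $T:X\to B(H)$ that is completely positive, i.e. $T_n(M_n(X)_+)\subset M_n(B(H))_+$ for all $n$. The bidual $X''$ carries its canonical involution, its canonical bidual operator space structure, and the cones $M_n(X'')_+$ defined as the weak* closure of $M_n(X)_+$ in $M_n(X'')$. We say that $X''$ is a \emph{unital operator system} with identity $1=1_{X''}$ if with these cones $X''$ is a matrix ordered $*$-vector space, $1$ is an Archimedean matrix order unit, and the norm of $M_n(X'')$ is the norm determined by it: $\|x\|=\inf\{t\ge 0:\left[\begin{smallmatrix} t1_n & x\\ x^* & t1_n\end{smallmatrix}\right]\in M_{2n}(X'')_+\}$ for all $n$ and $x \in M_n(X'')$. The \emph{Werner unitization} $X^+$ is $X\oplus\mathbb C$ with involution $(x,\lambda)^*=(x^*,\bar\lambda)$, unit $(0,1)$ and the following cones: $(v,A)\in M_n(X)\oplus M_n=M_n(X^+)$ is positive iff $v=v^*$, $A\ge 0$, and $\operatorname{Re}\varphi\big((A+\varepsilon)^{-1/2}\,v\,(A+\varepsilon)^{-1/2}\big)\ge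 -1$ for every $\varepsilon>0$ and every linear functional $\varphi$ on $M_n(X)$ that is contractive and nonnegative on $M_n(X)_+$; its matrix norms are those determined by these cones and the unit (by the formula above). \textbf{Lemma.} Let $X$ be an ordered operator space such that $X''$ is a unital operator system with identity $1$, and identify $X$ with its canonical copy in $X''$. The following are equivalent: (i) $X^+=\operatorname{Span}\{X,1\}\subset X''$, that is, $(x,\lambda)\mapsto x+\lambda 1$ is a linear isomorphism of $X^+$ onto $\operatorname{Span}\{X,1\}$ that is a complete order isomorphism and a complete isometry (for the cones and norms inherited from $X''$); (ii) there is no $v\in X$ with $v\ge 1$ in $X''$, i.e. with $v-1\in X''_+$; (iii) the distance in $X''$ from $1$ to $X$ equals $1$. -/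

import Mathlib

open scoped ComplexOrder MatrixOrder

universe u w

noncomputable section

namespace OrdOpSpace

/-! ### Matrices of operators -/

/-- The operator on the Hilbert space `Hⁿ` (the `ℓ²`-sum of `n` copies of `H`) given by an
`n × n` matrix of bounded operators on `H`: `(ξ_j)_j ↦ (∑ j, a i j ξ_j)_i`. -/
def matOp {H : Type w} [NormedAddCommGroup H] [InnerProductSpace ℂ H] {n : ℕ}
    (a : Matrix (Fin n) (Fin n) (H →L[ℂ] H)) :
    PiLp 2 (fun _ : Fin n => H) →L[ℂ] PiLp 2 (fun _ : Fin n => H) :=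
  ((PiLp.continuousLinearEquiv 2 ℂ (fun _ : Fin n => H)).symm :
      (Fin n → H) →L[ℂ] PiLp 2 (fun _ : Fin n => H)) ∘L
    ContinuousLinearMap.pi fun i =>
      ∑ j, a i j ∘L (PiLp.proj 2 (𝕜 := ℂ) (fun _ : Fin n => H) j)

theorem matOp_apply {H : Type w} [NormedAddCommGroup H] [InnerProductSpace ℂ H] {n : ℕ}
    (a : Matrix (Fin n) (Fin n) (H →L[ℂ] H)) (ξ : PiLp 2 (fun _ : Fin n => H)) (i : Fin n) :
    matOp a ξ i = ∑ j, a i j (ξ j) := by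
  simp [matOp]

/-! ### Ordered operator spaces -/

/-- The structure of an ordered operator space on a normed space `X` with isometric involution:
matrix norms and a cone in every `M_n(X)`, such that there is a `*`-linear complete isometry of `X`
into some `B(H)` that is completely positive. It need not be a complete order embedding. -/
structure OrderedOperatorSpace (X : Type u) [NormedAddCommGroup X] [NormedSpace ℂ X]
    [StarAddMonoid X] [StarModule ℂ X] [NormedStarGroup X] where
  /-- the norm of `M_n(X)` -/
  mnorm : ∀ n : ℕ, Matrix (Fin n) (Fin n) X → ℝ
  /-- the cone `M_n(X)₊` -/
  cone : ∀ n : ℕ, Set (Matrix (Fin n) (Fin n) X)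
  mnorm_one : ∀ x : X, mnorm 1 (Matrix.of fun _ _ => x) = ‖x‖
  zero_mem : ∀ n, (0 : Matrix (Fin n) (Fin n) X) ∈ cone n
  add_mem : ∀ n, ∀ x ∈ cone n, ∀ y ∈ cone n, x + y ∈ cone n
  smul_mem : ∀ n, ∀ r : ℝ, 0 ≤ r → ∀ x ∈ cone n, (r : ℂ) • x ∈ cone n
  exists_rep : ∃ (H : Type w) (_ : NormedAddCommGroup H) (_ : InnerProductSpace ℂ H)
    (_ : CompleteSpace H) (T : X →ₗ[ℂ] (H →L[ℂ] H)),
      (∀ x, T (star x) = ContinuousLinearMap.adjoint (T x)) ∧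
      (∀ n (x : Matrix (Fin n) (Fin n) X), ‖matOp (x.map T)‖ = mnorm n x) ∧
      (∀ n, ∀ x ∈ cone n, (matOp (x.map T)).IsPositive)

/-! ### Unital operator systems (Choi–Effros) -/

section OperatorSystem

variable {V : Type u} [AddCommGroup V] [Module ℂ V]

/-- The matrix `A ⊗ e`, with entries `A i j • e`. -/
def scalarMat {n : ℕ} (A : Matrix (Fin n) (Fin n) ℂ) (e : V) : Matrix (Fin n) (Fin n) V :=
  Matrix.of fun i j => A i j • e

/-- The compression `α* x α` of an `m × m` matrix over `V` by a scalar `m × n` matrix. -/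
def compress {m n : ℕ} (α : Matrix (Fin m) (Fin n) ℂ) (x : Matrix (Fin m) (Fin m) V) :
    Matrix (Fin n) (Fin n) V :=
  Matrix.of fun i j => ∑ k, ∑ l, (star (α k i) * α l j) • x k l

variable [StarAddMonoid V]

/-- The `2n × 2n` block matrix `[t e_n, x; x*, t e_n]`. -/
def normBlock {n : ℕ} (e : V) (t : ℝ) (x : Matrix (Fin n) (Fin n) V) :
    Matrix (Fin (n + n)) (Fin (n + n)) V :=
  Matrix.reindex finSumFinEquiv finSumFinEquiv
    (Matrix.fromBlocks (scalarMat ((t : ℂ) • 1) e) x x.conjTranspose (scalarMat ((t : ℂ) • 1) e))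

/-- The norm on `M_n(V)` determined by the matrix cones and the unit of an operator system:
`‖x‖ = inf {t ≥ 0 : [t e_n, x; x*, t e_n] ≥ 0}`. -/
def orderUnitNorm (C : ∀ n : ℕ, Set (Matrix (Fin n) (Fin n) V)) (e : V) {n : ℕ}
    (x : Matrix (Fin n) (Fin n) V) : ℝ :=
  sInf {t : ℝ | 0 ≤ t ∧ normBlock e t x ∈ C (n + n)}

/-- `V` with cones `C n` in `M_n(V)` is a matrix ordered `*`-vector space for which `e` is an
Archimedean matrix order unit. -/
structure IsOperatorSystem (C : ∀ n : ℕ, Set (Matrix (Fin n) (Fin n) V)) (e : V) : Prop where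
  isHermitian : ∀ n, ∀ x ∈ C n, x.IsHermitian
  zero_mem : ∀ n, (0 : Matrix (Fin n) (Fin n) V) ∈ C n
  add_mem : ∀ n, ∀ x ∈ C n, ∀ y ∈ C n, x + y ∈ C n
  smul_mem : ∀ n, ∀ r : ℝ, 0 ≤ r → ∀ x ∈ C n, (r : ℂ) • x ∈ C n
  proper : ∀ n, ∀ x ∈ C n, -x ∈ C n → x = 0
  compress_mem : ∀ m n (α : Matrix (Fin m) (Fin n) ℂ), ∀ x ∈ C m, compress α x ∈ C n
  star_unit : star e = e
  order_unit : ∀ n (x : Matrix (Fin n) (Fin n) V), x.IsHermitian →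
    ∃ r : ℝ, 0 < r ∧ scalarMat ((r : ℂ) • 1) e + x ∈ C n
  archimedean : ∀ n (x : Matrix (Fin n) (Fin n) V),
    (∀ r : ℝ, 0 < r → scalarMat ((r : ℂ) • 1) e + x ∈ C n) → x ∈ C n

/-- The operator space with matrix norms `N` and matrix cones `C` is a unital operator system with
identity `e`: the cones are those of an operator system, and the matrix norms are the ones that
the operator system determines. -/
structure IsUnitalOperatorSystem (N : ∀ n : ℕ, Matrix (Fin n) (Fin n) V → ℝ)
    (C : ∀ n : ℕ, Set (Matrix (Fin n) (Fin n) V)) (e : V) : Prop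
    extends IsOperatorSystem C e where
  norm_eq : ∀ n (x : Matrix (Fin n) (Fin n) V), N n x = orderUnitNorm C e x

end OperatorSystem

/-! ### The involution on dual spaces -/

section DualStar

variable {X : Type u} [NormedAddCommGroup X] [NormedSpace ℂ X] [StarAddMonoid X]
  [StarModule ℂ X] [NormedStarGroup X]

/-- The involution `φ*(x) = conj (φ (x*))` on the dual space. Applied twice, it gives the
involution of the bidual. -/
instance dualStar : Star (StrongDual ℂ X) where
  star φ := ((starL ℂ : ℂ ≃L⋆[ℂ] ℂ) : ℂ →L⋆[ℂ] ℂ).comp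
    (φ.comp ((starL ℂ : X ≃L⋆[ℂ] X) : X →L⋆[ℂ] X))

theorem dualStar_apply (φ : StrongDual ℂ X) (x : X) : (star φ) x = star (φ (star x)) := rfl

instance dualStarAddMonoid : StarAddMonoid (StrongDual ℂ X) where
  star_involutive φ := by ext x; simp [dualStar_apply]
  star_add φ ψ := by ext x; simp [dualStar_apply]

instance dualStarModule : StarModule ℂ (StrongDual ℂ X) where
  star_smul c φ := by ext x; simp [dualStar_apply]

instance dualNormedStarGroup : NormedStarGroup (StrongDual ℂ X) where
  norm_star_le φ := by
    refine ContinuousLinearMap.opNorm_le_bound _ (norm_nonneg _) fun x => ?_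
    rw [dualStar_apply, norm_star]
    simpa using φ.le_opNorm (star x)

end DualStar

/-! ### The bidual and the unitization -/

namespace OrderedOperatorSpace

variable {X : Type u} [NormedAddCommGroup X] [NormedSpace ℂ X] [StarAddMonoid X]
  [StarModule ℂ X] [NormedStarGroup X] (S : OrderedOperatorSpace.{u, w} X)

/-- The closed unit ball of `M_m(X') = CB(X, M_m)`: the matrices `φ` of functionals such that
`x ↦ [φ_{kl}(x)]` is completely contractive. -/
def dualBall (m : ℕ) : Set (Matrix (Fin m) (Fin m) (StrongDual ℂ X)) :=
  {φ | ∀ (p : ℕ) (x : Matrix (Fin p) (Fin p) X), S.mnorm p x ≤ 1 →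
    ‖Matrix.toEuclideanCLM (n := Fin m × Fin p) (𝕜 := ℂ)
      (Matrix.of fun a b => φ a.1 b.1 (x a.2 b.2))‖ ≤ 1}

/-- The norm of `M_n(X'') = CB(X', M_n)`: the completely bounded norm of `φ ↦ [η_{ij}(φ)]`. -/
def bidualNorm (n : ℕ) (η : Matrix (Fin n) (Fin n) (StrongDual ℂ (StrongDual ℂ X))) : ℝ :=
  sInf {c : ℝ | 0 ≤ c ∧ ∀ (m : ℕ), ∀ φ ∈ S.dualBall m,
    ‖Matrix.toEuclideanCLM (n := Fin n × Fin m) (𝕜 := ℂ)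
      (Matrix.of fun a b => η a.1 b.1 (φ a.2 b.2))‖ ≤ c}

/-- The cone of `M_n(X'')`: the weak* closure of the image of `M_n(X)₊`. -/
def bidualCone (n : ℕ) : Set (Matrix (Fin n) (Fin n) (StrongDual ℂ (StrongDual ℂ X))) :=
  {η | η.map StrongDual.toWeakDual ∈
    closure ((fun x : Matrix (Fin n) (Fin n) X =>
      (x.map (NormedSpace.inclusionInDoubleDual ℂ X)).map StrongDual.toWeakDual) '' S.cone n)}

/-- The positive contractive linear functionals on the normed space `M_n(X)`. -/
def positiveContractive (n : ℕ) : Set (Matrix (Fin n) (Fin n) X →ₗ[ℂ] ℂ) :=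
  {φ | (∀ x, ‖φ x‖ ≤ S.mnorm n x) ∧ ∀ x ∈ S.cone n, 0 ≤ φ x}

/-- The matrix cones of the Werner unitization `X⁺ = X ⊕ ℂ`: a selfadjoint `(v, A)` is positive iff
`A ≥ 0` and `φ ((A + ε)^{-1/2} v (A + ε)^{-1/2}) ≥ -1` for all `ε > 0` and all positive contractive
functionals `φ` on `M_n(X)`. (Taking real parts amounts to using only selfadjoint `φ`.) -/
def wernerCone (n : ℕ) : Set (Matrix (Fin n) (Fin n) (X × ℂ)) :=
  {u | (u.map Prod.fst).IsHermitian ∧ (u.map Prod.snd).PosSemidef ∧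
    ∀ ε : ℝ, 0 < ε → ∀ φ ∈ S.positiveContractive n,
      -1 ≤ (φ (compress (CFC.sqrt (u.map Prod.snd + (ε : ℂ) • 1))⁻¹ (u.map Prod.fst))).re}

/-- The span of the copy of `X` in `X''` and of `e`. -/
def spanUnit (X : Type u) [NormedAddCommGroup X] [NormedSpace ℂ X]
    (e : StrongDual ℂ (StrongDual ℂ X)) : Submodule ℂ (StrongDual ℂ (StrongDual ℂ X)) :=
  Submodule.span ℂ (Set.range (NormedSpace.inclusionInDoubleDual ℂ X) ∪ {e})

/-- `X⁺ = Span {X, e}`: there is a linear isomorphism of `X⁺ = X ⊕ ℂ` onto the span of `X` and `e`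
in `X''` that is the identity on `X`, takes the unit `(0, 1)` of `X⁺` to `e`, and is a complete
order isomorphism and a complete isometry. -/
def WernerEqSpan (e : StrongDual ℂ (StrongDual ℂ X)) : Prop :=
  ∃ Θ : (X × ℂ) ≃ₗ[ℂ] spanUnit X e,
    (∀ x : X, (Θ (x, 0) : StrongDual ℂ (StrongDual ℂ X)) =
      NormedSpace.inclusionInDoubleDual ℂ X x) ∧
    (Θ (0, 1) : StrongDual ℂ (StrongDual ℂ X)) = e ∧
    (∀ n (u : Matrix (Fin n) (Fin n) (X × ℂ)),
      u ∈ S.wernerCone n ↔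
        u.map (fun z => (Θ z : StrongDual ℂ (StrongDual ℂ X))) ∈ S.bidualCone n) ∧
    (∀ n (u : Matrix (Fin n) (Fin n) (X × ℂ)),
      orderUnitNorm S.wernerCone ((0, 1) : X × ℂ) u =
        S.bidualNorm n (u.map (fun z => (Θ z : StrongDual ℂ (StrongDual ℂ X)))))

/-- `v ∈ X` dominates `e` in `X''`: the element `v - e` lies in the cone of `X''`. -/
def Dominates (v : X) (e : StrongDual ℂ (StrongDual ℂ X)) : Prop :=
  Matrix.of (fun _ _ => NormedSpace.inclusionInDoubleDual ℂ X v - e) ∈ S.bidualCone 1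

end OrderedOperatorSpace

end OrdOpSpace

end

noncomputable section

namespace OrdOpSpace

/-! ### Scalar compressions of matrices over a vector space. -/

section Compress

variable {V : Type u} [AddCommGroup V] [Module ℂ V]

/-! The core is `map_add_unit_mem_bidualCone_iff`: for selfadjoint `w` in `M_n(X)`, positivity of `w
+ 1` in the bidual is detected by the positive contractive functionals on `M_n(X)`. Such a
functional is a weak* continuous pairing, so it stays nonnegative on the bidual cone, and its value
at the unit has modulus at most `1`. Conversely, if `w + 1` is not positive, Hahn–Banach gives a
separating pairing; its selfadjoint part is bounded by its value at the unit
(`IsOperatorSystem.norm_apply_le`), so dividing by that value makes it a positive contractive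
functional that is less than `-1` at `w`.

Conjugating by `(A + ε)^{1/2}` and letting `ε → 0` by the Archimedean property shows that, when `v`
is selfadjoint and `A ≥ 0`, the Werner cone condition always agrees with positivity of `v + A ⊗ e`
in the bidual. So (i) depends only on whether positivity there forces `A ≥ 0`. If `ξ* A ξ < 0`,
compressing by `ξ` and rescaling gives an element of `X` above `e`; conversely, if `v ≥ e`, then
`(v, -1)` is positive with a negative scalar part. Once the cones agree, so do the norms, which they
determine.

For the distance, `‖e - x‖ < 1` makes a positive multiple of `x + x*` dominate `e`, while `e ≤ v ≤ r
e` puts a small multiple of `v` at distance less than `1` from `e`. -/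

theorem compress_apply {m n : ℕ} (α : Matrix (Fin m) (Fin n) ℂ) (x : Matrix (Fin m) (Fin m) V)
    (i j : Fin n) : compress α x i j = ∑ k, ∑ l, (star (α k i) * α l j) • x k l := rfl

theorem scalarMat_apply {n : ℕ} (A : Matrix (Fin n) (Fin n) ℂ) (e : V) (i j : Fin n) :
    scalarMat A e i j = A i j • e := rfl

theorem scalarMat_add {n : ℕ} (A B : Matrix (Fin n) (Fin n) ℂ) (e : V) :
    scalarMat (A + B) e = scalarMat A e + scalarMat B e := by
  ext i j
  simp [scalarMat_apply, add_smul]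

theorem scalarMat_smul {n : ℕ} (c : ℂ) (A : Matrix (Fin n) (Fin n) ℂ) (e : V) :
    scalarMat (c • A) e = c • scalarMat A e := by
  ext i j
  simp [scalarMat_apply, mul_smul]

theorem compress_add {m n : ℕ} (α : Matrix (Fin m) (Fin n) ℂ) (x y : Matrix (Fin m) (Fin m) V) :
    compress α (x + y) = compress α x + compress α y := by
  ext i j
  simp [compress_apply, Finset.sum_add_distrib]

theorem compress_one {n : ℕ} (x : Matrix (Fin n) (Fin n) V) : compress 1 x = x := by
  ext i j
  simp [compress_apply, Matrix.one_apply]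

theorem compress_compress {l m n : ℕ} (α : Matrix (Fin l) (Fin m) ℂ) (β : Matrix (Fin m) (Fin n) ℂ)
    (x : Matrix (Fin l) (Fin l) V) : compress β (compress α x) = compress (α * β) x := by
  ext i j
  simp only [compress_apply, Matrix.mul_apply, star_sum, star_mul', Finset.smul_sum,
    Finset.sum_mul_sum, Finset.sum_smul, smul_smul]
  simp_rw [Finset.sum_comm (s := (Finset.univ : Finset (Fin m)))
    (t := (Finset.univ : Finset (Fin l)))]
  refine Finset.sum_congr rfl fun a _ => Finset.sum_congr rfl fun b _ =>
    Finset.sum_congr rfl fun c _ => Finset.sum_congr rfl fun d _ => ?_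
  congr 1
  ring

theorem compress_scalarMat {m n : ℕ} (α : Matrix (Fin m) (Fin n) ℂ) (A : Matrix (Fin m) (Fin m) ℂ)
    (e : V) : compress α (scalarMat A e) = scalarMat (α.conjTranspose * A * α) e := by
  ext i j
  simp only [compress_apply, scalarMat_apply, Matrix.mul_apply, Finset.sum_mul, Finset.sum_smul,
    smul_smul, Matrix.conjTranspose_apply]
  rw [Finset.sum_comm]
  refine Finset.sum_congr rfl fun a _ => Finset.sum_congr rfl fun b _ => ?_
  congr 1
  ring

theorem map_compress {W F : Type*} [AddCommGroup W] [Module ℂ W] [FunLike F V W]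
    [LinearMapClass F ℂ V W] (f : F) {m n : ℕ} (α : Matrix (Fin m) (Fin n) ℂ)
    (x : Matrix (Fin m) (Fin m) V) : (compress α x).map f = compress α (x.map f) := by
  ext i j
  simp [compress_apply]

end Compress

/-! ### Matrix order units and the norm they determine. -/

section OperatorSystem

variable {V : Type u} [AddCommGroup V] [Module ℂ V] [StarAddMonoid V]

theorem isHermitian_compress [StarModule ℂ V] {m n : ℕ} (α : Matrix (Fin m) (Fin n) ℂ)
    {x : Matrix (Fin m) (Fin m) V} (hx : x.IsHermitian) : (compress α x).IsHermitian := by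
  ext i j
  simp only [Matrix.conjTranspose_apply, compress_apply, star_sum, star_smul, star_mul', star_star,
    hx.apply]
  rw [Finset.sum_comm]
  simp only [mul_comm]

/-- The column `[1; c]` of `n × n` scalar blocks. -/
def blockColumn (n : ℕ) (c : ℂ) : Matrix (Fin (n + n)) (Fin n) ℂ :=
  Matrix.of fun k i => Sum.elim (fun a => (1 : Matrix (Fin n) (Fin n) ℂ) a i)
    (fun a => c * (1 : Matrix (Fin n) (Fin n) ℂ) a i) (finSumFinEquiv.symm k)

/-- Turns a norm bound into an order inequality in `M_n`: unimodular `c` serves to bound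
functionals, `c = -1` to extract the selfadjoint part. -/
theorem compress_blockColumn_normBlock {n : ℕ} (c : ℂ) (e : V) (t : ℝ)
    (x : Matrix (Fin n) (Fin n) V) :
    compress (blockColumn n c) (normBlock e t x) =
      scalarMat (((1 + star c * c) * t) • 1) e + (c • x + star c • x.conjTranspose) := by
  ext i j
  rw [compress_apply, ← finSumFinEquiv.sum_comp, Fintype.sum_sum_type]
  simp_rw [← finSumFinEquiv.sum_comp (fun l : Fin (n + n) => _ • normBlock e t x _ l),
    Fintype.sum_sum_type]
  simp only [blockColumn, normBlock, Matrix.of_apply, Equiv.symm_apply_apply, Sum.elim_inl,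
    Sum.elim_inr, Matrix.reindex_apply, Matrix.submatrix_apply, Matrix.fromBlocks_apply₁₁,
    Matrix.fromBlocks_apply₁₂, Matrix.fromBlocks_apply₂₁, Matrix.fromBlocks_apply₂₂,
    Matrix.one_apply, scalarMat_apply, Matrix.add_apply, Matrix.smul_apply]
  simp only [apply_ite star, star_one, star_zero, ite_mul, one_mul, zero_mul, mul_ite, mul_one,
    mul_zero, ite_smul, zero_smul, Finset.sum_add_distrib, Finset.sum_ite_eq', Finset.mem_univ,
    if_true]
  by_cases h : i = j
  · simp [h, add_mul, add_smul, mul_smul]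
    abel
  · simp [h]

theorem normBlock_eq_add {n : ℕ} (e : V) (t : ℝ) (x : Matrix (Fin n) (Fin n) V) :
    normBlock e t x = scalarMat ((t : ℂ) • 1) e + normBlock e 0 x := by
  ext i j
  obtain ⟨i, rfl⟩ := finSumFinEquiv.surjective i
  obtain ⟨j, rfl⟩ := finSumFinEquiv.surjective j
  rcases i with i | i <;> rcases j with j | j <;>
    simp [normBlock, scalarMat_apply, Matrix.one_apply, Fin.ext_iff, -finSumFinEquiv_apply_left,
      -finSumFinEquiv_apply_right]

theorem isHermitian_normBlock_zero {n : ℕ} (e : V) (x : Matrix (Fin n) (Fin n) V) :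
    (normBlock e 0 x).IsHermitian := by
  have : (scalarMat (((0 : ℝ) : ℂ) • (1 : Matrix (Fin n) (Fin n) ℂ)) e) = 0 := by
    ext i j
    simp [scalarMat_apply]
  rw [normBlock, this, Matrix.reindex_apply]
  refine Matrix.IsHermitian.submatrix ?_ _
  rw [Matrix.IsHermitian, Matrix.fromBlocks_conjTranspose]
  simp

theorem map_normBlock {W F : Type*} [AddCommGroup W] [Module ℂ W] [StarAddMonoid W] [FunLike F V W]
    [LinearMapClass F ℂ V W] (f : F) (hf : ∀ v, f (star v) = star (f v)) {n : ℕ} (e : V) (t : ℝ)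
    (x : Matrix (Fin n) (Fin n) V) : (normBlock e t x).map f = normBlock (f e) t (x.map f) := by
  ext i j
  obtain ⟨i, rfl⟩ := finSumFinEquiv.surjective i
  obtain ⟨j, rfl⟩ := finSumFinEquiv.surjective j
  rcases i with i | i <;> rcases j with j | j <;>
    simp [normBlock, scalarMat_apply, hf, -finSumFinEquiv_apply_left, -finSumFinEquiv_apply_right]

variable {C : ∀ n : ℕ, Set (Matrix (Fin n) (Fin n) V)} {e : V}

namespace IsOperatorSystem

theorem scalarMat_one_mem (h : IsOperatorSystem C e) (n : ℕ) : scalarMat 1 e ∈ C n := by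
  obtain ⟨r, hr, hmem⟩ := h.order_unit n 0 Matrix.isHermitian_zero
  have := h.smul_mem n r⁻¹ (inv_nonneg.2 hr.le) _ hmem
  rwa [add_zero, scalarMat_smul, smul_smul, ← Complex.ofReal_mul, inv_mul_cancel₀ hr.ne',
    Complex.ofReal_one, one_smul] at this

theorem scalarMat_mem (h : IsOperatorSystem C e) {n : ℕ} {A : Matrix (Fin n) (Fin n) ℂ}
    (hA : A.PosSemidef) : scalarMat A e ∈ C n := by
  have hs : CFC.sqrt A * CFC.sqrt A = A := CFC.sqrt_mul_sqrt_self A hA.nonneg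
  have hh : (CFC.sqrt A).conjTranspose = CFC.sqrt A :=
    (Matrix.nonneg_iff_posSemidef.1 (CFC.sqrt_nonneg A)).isHermitian
  have := h.compress_mem n n (CFC.sqrt A) _ (h.scalarMat_one_mem n)
  rwa [compress_scalarMat, hh, mul_one, hs] at this

theorem nonempty_normBlock_mem (h : IsOperatorSystem C e) {n : ℕ} (x : Matrix (Fin n) (Fin n) V) :
    {t : ℝ | 0 ≤ t ∧ normBlock e t x ∈ C (n + n)}.Nonempty := by
  obtain ⟨r, hr, hmem⟩ := h.order_unit _ _ (isHermitian_normBlock_zero e x)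
  exact ⟨r, hr.le, by rwa [normBlock_eq_add]⟩

/-- A selfadjoint functional that is nonnegative on the cone is bounded, in the order unit norm,
by its value at the unit. -/
theorem norm_apply_le (h : IsOperatorSystem C e) {n : ℕ} (f : Matrix (Fin n) (Fin n) V →ₗ[ℂ] ℂ)
    (hf : ∀ x ∈ C n, 0 ≤ (f x).re) (hstar : ∀ x, f x.conjTranspose = star (f x))
    (x : Matrix (Fin n) (Fin n) V) :
    ‖f x‖ ≤ (f (scalarMat 1 e)).re * orderUnitNorm C e x := by
  have hone : 0 ≤ (f (scalarMat 1 e)).re := hf _ (h.scalarMat_one_mem n)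
  have key : ∀ t : ℝ, normBlock e t x ∈ C (n + n) → ‖f x‖ ≤ (f (scalarMat 1 e)).re * t := by
    intro t ht
    -- The phase is chosen so that compressing by `[1; c]` and applying `f` gives `2 t f(1) - 2 ‖f
    -- x‖ ≥ 0`.
    obtain ⟨c, hc, hcx⟩ : ∃ c : ℂ, star c * c = 1 ∧ c * f x = -(‖f x‖ : ℂ) := by
      obtain ⟨c, hc, hcx⟩ := Complex.exists_norm_mul_eq_self (f x)
      have h1 : star c * c = 1 := by
        rw [mul_comm]
        simpa [hc] using Complex.mul_conj' c
      refine ⟨-star c, ?_, ?_⟩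
      · simpa [mul_comm] using h1
      · linear_combination star c * hcx - (‖f x‖ : ℂ) * h1
    have := hf _ (h.compress_mem _ _ (blockColumn n c) _ ht)
    rw [compress_blockColumn_normBlock, hc, map_add, map_add, map_smul, map_smul, hstar,
      scalarMat_smul, map_smul, smul_eq_mul, smul_eq_mul, smul_eq_mul, ← star_mul', hcx] at this
    simp at this
    norm_num at this
    nlinarith
  -- When `f(1) = 0` one cannot divide by it, but a single admissible `t` already forces `f x = 0`.
  rcases hone.eq_or_lt with h0 | h0
  · obtain ⟨t, -, ht⟩ := h.nonempty_normBlock_mem x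
    simpa [← h0] using key t ht
  · rw [← div_le_iff₀' h0]
    refine le_csInf (h.nonempty_normBlock_mem x) fun t ht => ?_
    rw [div_le_iff₀' h0]
    exact key t ht.2

/-- If `-s e ≤ y ≤ s e` then `‖y‖ ≤ s`. -/
theorem orderUnitNorm_le (h : IsOperatorSystem C e) {y : V} {s : ℝ} (hs : 0 ≤ s)
    (hstar : star y = y)
    (h₁ : (Matrix.of fun _ _ => (s : ℂ) • e + y) ∈ C 1)
    (h₂ : (Matrix.of fun _ _ => (s : ℂ) • e - y) ∈ C 1) :
    orderUnitNorm C e (Matrix.of fun _ _ : Fin 1 => y) ≤ s := by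
  refine csInf_le ⟨0, fun t ht => ht.1⟩ ⟨hs, ?_⟩
  have hh : (0 : ℝ) ≤ 1 / 2 := by norm_num
  -- `[s, y; y, s]` is half of `(s + y) ⊗ [1, 1; 1, 1]` plus half of `(s - y) ⊗ [1, -1; -1, 1]`;
  -- each term compresses a positive element by a row.
  have m₁ := h.smul_mem _ _ hh _ (h.compress_mem 1 (1 + 1) (Matrix.of fun _ _ => 1) _ h₁)
  have m₂ := h.smul_mem _ _ hh _ (h.compress_mem 1 (1 + 1)
    (Matrix.of fun _ j => Sum.elim (fun _ => 1) (fun _ => -1) (finSumFinEquiv.symm j)) _ h₂)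
  convert h.add_mem _ _ m₁ _ m₂ using 1
  ext i j
  obtain ⟨i, rfl⟩ := finSumFinEquiv.surjective i
  obtain ⟨j, rfl⟩ := finSumFinEquiv.surjective j
  rcases i with i | i <;> rcases j with j | j <;> fin_cases i <;> fin_cases j <;>
    simp [normBlock, scalarMat_apply, compress_apply, hstar, -finSumFinEquiv_apply_left,
      -finSumFinEquiv_apply_right] <;> module

theorem sub_mem_of_orderUnitNorm_lt {n : ℕ} (h : IsOperatorSystem C e)
    {x : Matrix (Fin n) (Fin n) V} {s : ℝ} (hx : orderUnitNorm C e x < s) :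
    ∃ t < s, scalarMat (((2 * t : ℝ) : ℂ) • 1) e - (x + x.conjTranspose) ∈ C n := by
  obtain ⟨t, ht, hts⟩ := exists_lt_of_csInf_lt (h.nonempty_normBlock_mem x) hx
  refine ⟨t, hts, ?_⟩
  have := h.compress_mem _ _ (blockColumn n (-1)) _ ht.2
  rw [compress_blockColumn_normBlock] at this
  convert this using 1
  simp [one_add_one_eq_two]
  abel

end IsOperatorSystem

end OperatorSystem

end OrdOpSpace

end

noncomputable section

namespace OrdOpSpace

/-! ### Adjoining the unit: domination and distance. -/

section AdjoinUnit

variable {X : Type*} [AddCommGroup X] [Module ℂ X] {V : Type*} [AddCommGroup V] [Module ℂ V]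

/-- The linear map `(x, c) ↦ J x + c e`. -/
def addUnit (J : X →ₗ[ℂ] V) (e : V) : (X × ℂ) →ₗ[ℂ] V :=
  J.coprod (LinearMap.toSpanSingleton ℂ V e)

theorem addUnit_apply (J : X →ₗ[ℂ] V) (e : V) (z : X × ℂ) :
    addUnit J e z = J z.1 + z.2 • e := rfl

theorem addUnit_inl (J : X →ₗ[ℂ] V) (e : V) (x : X) : addUnit J e (x, 0) = J x := by
  simp [addUnit_apply]

theorem addUnit_unit (J : X →ₗ[ℂ] V) (e : V) : addUnit J e (0, 1) = e := by
  simp [addUnit_apply]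

theorem range_addUnit (J : X →ₗ[ℂ] V) (e : V) :
    LinearMap.range (addUnit J e) = Submodule.span ℂ (Set.range J ∪ {e}) := by
  rw [addUnit, LinearMap.range_coprod, LinearMap.range_toSpanSingleton, Submodule.span_union]
  congr 1
  exact (Submodule.span_eq (LinearMap.range J)).symm

theorem addUnit_injective {J : X →ₗ[ℂ] V} {e : V} (hJ : Function.Injective J)
    (h : ∀ v, J v ≠ e) : Function.Injective (addUnit J e) := by
  rw [injective_iff_map_eq_zero]
  rintro ⟨x, c⟩ hz
  simp only [addUnit_apply] at hz
  by_cases hc : c = 0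
  · subst hc
    rw [zero_smul, add_zero] at hz
    rw [hJ (hz.trans (map_zero _).symm)]
    rfl
  · refine absurd ?_ (h (-c⁻¹ • x))
    rw [map_smul, eq_neg_of_add_eq_zero_left hz, smul_neg, smul_smul]
    simp [hc]

theorem map_addUnit (J : X →ₗ[ℂ] V) (e : V) {n : ℕ} (z : Matrix (Fin n) (Fin n) (X × ℂ)) :
    z.map (addUnit J e) = (z.map Prod.fst).map J + scalarMat (z.map Prod.snd) e := rfl

variable [StarAddMonoid V] {J : X →ₗ[ℂ] V} {e : V}
  {C : ∀ n : ℕ, Set (Matrix (Fin n) (Fin n) V)}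

namespace IsOperatorSystem

theorem unit_mem (h : IsOperatorSystem C e) : (Matrix.of fun _ _ => e) ∈ C 1 := by
  convert h.scalarMat_one_mem 1 using 1
  ext i j
  simp [scalarMat_apply, Subsingleton.elim i j]

theorem orderUnitNorm_unit_le (h : IsOperatorSystem C e) :
    orderUnitNorm C e (Matrix.of fun _ _ : Fin 1 => e) ≤ 1 := by
  refine h.orderUnitNorm_le zero_le_one h.star_unit ?_ ?_
  · convert h.add_mem 1 _ h.unit_mem _ h.unit_mem using 1
    ext i j
    simp
  · convert h.zero_mem 1 using 1
    ext i j
    simp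

theorem ne_unit_of_forall_notMem (h : IsOperatorSystem C e)
    (hno : ∀ v, (Matrix.of fun _ _ => J v - e) ∉ C 1) (v : X) : J v ≠ e := by
  intro hv
  refine hno v ?_
  rw [hv, sub_self]
  exact h.zero_mem 1

/-- A vector `ξ` with `ξ* A ξ = r < 0` compresses the positive matrix to `x + r e` with `x` in the
image of `J`; dividing by `-r` gives a forbidden element above `e`. -/
theorem posSemidef_of_mem (h : IsOperatorSystem C e)
    (hno : ∀ v, (Matrix.of fun _ _ => J v - e) ∉ C 1) {n : ℕ} {v : Matrix (Fin n) (Fin n) X}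
    {A : Matrix (Fin n) (Fin n) ℂ} (hA : A.IsHermitian) (hmem : v.map J + scalarMat A e ∈ C n) :
    A.PosSemidef := by
  refine Matrix.PosSemidef.of_dotProduct_mulVec_nonneg hA fun ξ => ?_
  by_contra hneg
  have hre : (star ξ ⬝ᵥ A.mulVec ξ).re < 0 := by
    by_contra! hre
    exact hneg (Complex.nonneg_iff.2 ⟨hre, (hA.im_star_dotProduct_mulVec_self ξ).symm⟩)
  have him : (((star ξ ⬝ᵥ A.mulVec ξ).re : ℝ) : ℂ) = star ξ ⬝ᵥ A.mulVec ξ :=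
    Complex.ext rfl (hA.im_star_dotProduct_mulVec_self ξ).symm
  set r := (star ξ ⬝ᵥ A.mulVec ξ).re with hr
  let α : Matrix (Fin n) (Fin 1) ℂ := Matrix.of fun k _ => ξ k
  have hmem' := h.smul_mem 1 (-r)⁻¹ (by
    rw [inv_nonneg]
    linarith) _ (h.compress_mem n 1 α _ hmem)
  refine hno ((((-r)⁻¹ : ℝ) : ℂ) • compress α v 0 0) ?_
  convert hmem' using 1
  have hα : (α.conjTranspose * A * α) 0 0 = (r : ℂ) := by
    rw [him, Matrix.mul_assoc]
    rfl
  ext i j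
  rw [Subsingleton.elim i 0, Subsingleton.elim j 0, compress_add, compress_scalarMat,
    ← map_compress, Matrix.smul_apply, Matrix.add_apply, scalarMat_apply, hα, smul_add, smul_smul,
    ← Complex.ofReal_mul, inv_neg, neg_mul, inv_mul_cancel₀ hre.ne, Matrix.of_apply, map_smul,
    Matrix.map_apply]
  simp [sub_eq_add_neg]

/-- With `t < 1` admissible for `e - J x`, the selfadjoint part gives `J (x + x*) ≥ 2 (1 - t) e`;
rescale. -/
theorem exists_dominating_of_orderUnitNorm_lt [StarAddMonoid X]
    (h : IsOperatorSystem C e) (hJ : ∀ x, J (star x) = star (J x)) {x : X}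
    (hx : orderUnitNorm C e (Matrix.of fun _ _ : Fin 1 => e - J x) < 1) :
    ∃ v, (Matrix.of fun _ _ => J v - e) ∈ C 1 := by
  obtain ⟨t, ht, hmem⟩ := h.sub_mem_of_orderUnitNorm_lt hx
  have hpos : 0 < 2 * (1 - t) := by linarith
  have hc : (((2 * (1 - t))⁻¹ : ℝ) : ℂ) * (2 - 2 * t) = 1 := by
    have : ((2 : ℂ) - 2 * t) = ((2 * (1 - t) : ℝ) : ℂ) := by push_cast; ring
    rw [this, ← Complex.ofReal_mul, inv_mul_cancel₀ hpos.ne', Complex.ofReal_one]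
  refine ⟨(((2 * (1 - t))⁻¹ : ℝ) : ℂ) • (x + star x), ?_⟩
  convert h.smul_mem 1 (2 * (1 - t))⁻¹ (inv_nonneg.2 hpos.le) _ hmem using 1
  ext i j
  rw [Matrix.smul_apply, Matrix.sub_apply, Matrix.add_apply, scalarMat_apply,
    Matrix.conjTranspose_apply, Matrix.smul_apply, Subsingleton.elim i j, Matrix.one_apply_eq,
    Matrix.of_apply, Matrix.of_apply, star_sub, h.star_unit, map_smul, map_add, hJ]
  generalize (((2 * (1 - t))⁻¹ : ℝ) : ℂ) = c at hc ⊢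
  have hce : e = (c * (2 - 2 * t)) • e := by rw [hc, one_smul]
  nth_rewrite 1 [hce]
  push_cast
  module

variable [StarModule ℂ V]

theorem exists_orderUnitNorm_lt_of_dominating (h : IsOperatorSystem C e) {v : X}
    (hv : (Matrix.of fun _ _ => J v - e) ∈ C 1) :
    ∃ x, orderUnitNorm C e (Matrix.of fun _ _ : Fin 1 => e - J x) < 1 := by
  have hstar : star (J v) = J v := by
    have := congrFun (congrFun (h.isHermitian 1 _ hv) 0) 0
    rw [Matrix.conjTranspose_apply, Matrix.of_apply, star_sub, h.star_unit] at this
    exact sub_left_injective this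
  obtain ⟨r, hr, hmem⟩ := h.order_unit 1 (Matrix.of fun _ _ => -J v) (by
    ext i j
    simp [hstar])
  have hmem' : (Matrix.of fun _ _ => (r : ℂ) • e - J v) ∈ C 1 := by
    convert hmem using 1
    ext i j
    simp [scalarMat_apply, Subsingleton.elim i j, sub_eq_add_neg]
  -- With `J v ≤ r e` and `1 - t = t r`, the two bounds on `e - t J v` are `(1 - t) e + (e - t J v)
  -- = t (r e - J v) + e ≥ 0` and `(1 - t) e - (e - t J v) = t (J v - e) ≥ 0`.
  obtain ⟨t, ht, htr⟩ : ∃ t : ℝ, 0 < t ∧ t * (r + 1) = 1 :=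
    ⟨(r + 1)⁻¹, by positivity, inv_mul_cancel₀ (by positivity)⟩
  have ht1 : t ≤ 1 := by nlinarith
  refine ⟨(t : ℂ) • v, (h.orderUnitNorm_le (s := 1 - t) (by linarith) ?_ ?_ ?_).trans_lt
    (by linarith)⟩
  · simp [hstar, h.star_unit]
  · convert h.add_mem _ _ (h.smul_mem _ t ht.le _ hmem') _ h.unit_mem using 1
    have htc : ((1 : ℂ) - t) = t * r := by
      have : (t : ℂ) * (r + 1) = 1 := by exact_mod_cast htr
      linear_combination -this
    ext i j
    simp only [Matrix.of_apply, Matrix.add_apply, Matrix.smul_apply, map_smul]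
    rw [Complex.ofReal_sub, Complex.ofReal_one, htc]
    module
  · convert h.smul_mem _ t ht.le _ hv using 1
    ext i j
    simp only [Matrix.of_apply, Matrix.smul_apply, map_smul]
    push_cast
    module

end IsOperatorSystem

variable [StarAddMonoid X] [StarModule ℂ V]

theorem addUnit_star (hJ : ∀ x, J (star x) = star (J x)) (h : star e = e) (z : X × ℂ) :
    addUnit J e (star z) = star (addUnit J e z) := by
  simp [addUnit_apply, hJ, h]

/-- The norm is defined from the cones and the unit, so matching cones yields the complete isometry
at once. -/
theorem orderUnitNorm_map_addUnit (hJ : ∀ x, J (star x) = star (J x)) (h : star e = e)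
    {D : ∀ n : ℕ, Set (Matrix (Fin n) (Fin n) (X × ℂ))}
    (hD : ∀ n z, z ∈ D n ↔ z.map (addUnit J e) ∈ C n) {n : ℕ}
    (z : Matrix (Fin n) (Fin n) (X × ℂ)) :
    orderUnitNorm D ((0, 1) : X × ℂ) z = orderUnitNorm C e (z.map (addUnit J e)) := by
  simp_rw [orderUnitNorm, hD, map_normBlock (addUnit J e) (addUnit_star hJ h), addUnit_unit]

namespace IsOperatorSystem

theorem isHermitian_of_map_addUnit_mem (h : IsOperatorSystem C e) (hinj : Function.Injective J)
    (hJ : ∀ x, J (star x) = star (J x)) (hno : ∀ v, (Matrix.of fun _ _ => J v - e) ∉ C 1) {n : ℕ}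
    {z : Matrix (Fin n) (Fin n) (X × ℂ)} (hmem : z.map (addUnit J e) ∈ C n) : z.IsHermitian := by
  refine Matrix.ext fun i j => addUnit_injective hinj (h.ne_unit_of_forall_notMem hno) ?_
  rw [Matrix.conjTranspose_apply, addUnit_star hJ h.star_unit]
  exact congrFun (congrFun (h.isHermitian n _ hmem) i) j

end IsOperatorSystem

end AdjoinUnit

end OrdOpSpace

end

noncomputable section

namespace OrdOpSpace

/-! ### Norms of scalar matrices through sesquilinear forms. -/

section MatrixNorm

variable {ι κ : Type*} [Fintype ι] [Fintype κ] [DecidableEq ι] [DecidableEq κ]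

theorem inner_toEuclideanCLM_apply (A : Matrix ι ι ℂ) (a b : EuclideanSpace ℂ ι) :
    inner ℂ b (Matrix.toEuclideanCLM (n := ι) (𝕜 := ℂ) A a) =
      ∑ i, ∑ j, (star (b i) * a j) * A i j := by
  rw [PiLp.inner_apply]
  refine Finset.sum_congr rfl fun i _ => ?_
  rw [Matrix.ofLp_toEuclideanCLM, Matrix.mulVec, dotProduct, RCLike.inner_apply, Finset.sum_mul]
  refine Finset.sum_congr rfl fun j _ => ?_
  simp only [Complex.star_def]
  ring

theorem norm_toEuclideanCLM_le {A : Matrix ι ι ℂ} {c : ℝ} (hc : 0 ≤ c)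
    (h : ∀ a b : EuclideanSpace ℂ ι,
      ‖∑ i, ∑ j, (star (b i) * a j) * A i j‖ ≤ c * (‖b‖ * ‖a‖)) :
    ‖Matrix.toEuclideanCLM (n := ι) (𝕜 := ℂ) A‖ ≤ c := by
  refine ContinuousLinearMap.opNorm_le_bound _ hc fun a => ?_
  have := h a (Matrix.toEuclideanCLM (n := ι) (𝕜 := ℂ) A a)
  rw [← inner_toEuclideanCLM_apply, inner_self_eq_norm_sq_to_K] at this
  rcases (norm_nonneg (Matrix.toEuclideanCLM (n := ι) (𝕜 := ℂ) A a)).eq_or_lt with h0 | h0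
  · rw [← h0]
    positivity
  · refine le_of_mul_le_mul_left ?_ h0
    simp at this
    linarith

theorem norm_sum_le_norm_toEuclideanCLM (A : Matrix ι ι ℂ) (a b : EuclideanSpace ℂ ι) :
    ‖∑ i, ∑ j, (star (b i) * a j) * A i j‖ ≤
      ‖Matrix.toEuclideanCLM (n := ι) (𝕜 := ℂ) A‖ * (‖b‖ * ‖a‖) := by
  rw [← inner_toEuclideanCLM_apply]
  refine (norm_inner_le_norm _ _).trans ?_
  have := (Matrix.toEuclideanCLM (n := ι) (𝕜 := ℂ) A).le_opNorm a
  nlinarith [norm_nonneg b]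

theorem norm_toEuclideanCLM_submatrix_le (A : Matrix ι ι ℂ) (σ : κ ≃ ι) :
    ‖Matrix.toEuclideanCLM (n := κ) (𝕜 := ℂ) (A.submatrix σ σ)‖ ≤
      ‖Matrix.toEuclideanCLM (n := ι) (𝕜 := ℂ) A‖ := by
  refine norm_toEuclideanCLM_le (norm_nonneg _) fun a b => ?_
  have hn : ∀ a : EuclideanSpace ℂ κ,
      ‖(WithLp.toLp 2 (a ∘ σ.symm) : EuclideanSpace ℂ ι)‖ = ‖a‖ := by
    intro a
    rw [EuclideanSpace.norm_eq, EuclideanSpace.norm_eq, ← σ.sum_comp]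
    simp
  have := norm_sum_le_norm_toEuclideanCLM A (WithLp.toLp 2 (a ∘ σ.symm))
    (WithLp.toLp 2 (b ∘ σ.symm))
  rw [hn, hn, ← σ.sum_comp] at this
  simp_rw [← σ.sum_comp (fun j => _ * A _ j)] at this
  simpa using this

theorem norm_toEuclideanCLM_submatrix (A : Matrix ι ι ℂ) (σ : κ ≃ ι) :
    ‖Matrix.toEuclideanCLM (n := κ) (𝕜 := ℂ) (A.submatrix σ σ)‖ =
      ‖Matrix.toEuclideanCLM (n := ι) (𝕜 := ℂ) A‖ := by
  refine le_antisymm (norm_toEuclideanCLM_submatrix_le A σ) ?_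
  simpa using norm_toEuclideanCLM_submatrix_le (A.submatrix σ σ) σ.symm

end MatrixNorm

/-! ### Matrix norms on `X`, its dual and its bidual. -/

namespace OrderedOperatorSpace

variable {X : Type u} [NormedAddCommGroup X] [NormedSpace ℂ X] [StarAddMonoid X]
  [StarModule ℂ X] [NormedStarGroup X] (S : OrderedOperatorSpace.{u, w} X)

section MatOp

variable {H : Type w} [NormedAddCommGroup H] [InnerProductSpace ℂ H]

theorem norm_matOp_single_le {n : ℕ} (i j : Fin n) (T : H →L[ℂ] H) :
    ‖matOp (Matrix.single i j T)‖ ≤ ‖T‖ := by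
  refine ContinuousLinearMap.opNorm_le_bound _ (norm_nonneg _) fun ξ => ?_
  have : matOp (Matrix.single i j T) ξ = PiLp.single 2 i (T (ξ j)) := by
    ext k
    rw [matOp_apply]
    by_cases h : k = i
    · subst h
      rw [Finset.sum_eq_single j]
      · simp
      · intro l _ hl
        simp [Matrix.single, hl.symm]
      · simp
    · simp [Matrix.single, Ne.symm h, h]
  rw [this, PiLp.norm_single]
  exact (T.le_opNorm _).trans (by gcongr; exact PiLp.norm_apply_le ξ j)

theorem norm_matOp_diagonal_le {n : ℕ} (T : H →L[ℂ] H) :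
    ‖matOp (Matrix.diagonal fun _ : Fin n => T)‖ ≤ ‖T‖ := by
  refine ContinuousLinearMap.opNorm_le_bound _ (norm_nonneg _) fun ξ => ?_
  have : ∀ k, matOp (Matrix.diagonal fun _ : Fin n => T) ξ k = T (ξ k) := by
    intro k
    rw [matOp_apply, Finset.sum_eq_single k]
    · simp
    · intro l _ hl
      simp [Matrix.diagonal, hl.symm]
    · simp
  rw [PiLp.norm_eq_of_L2, PiLp.norm_eq_of_L2]
  refine Real.sqrt_le_iff.2 ⟨by positivity, ?_⟩
  rw [mul_pow, Real.sq_sqrt (by positivity), Finset.mul_sum]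
  refine Finset.sum_le_sum fun k _ => ?_
  rw [this, ← mul_pow]
  gcongr
  exact T.le_opNorm _

/-- Pair `matOp x` applied to `(a_i h)` with `(b_i k)`, where `k` is the value of the sum at `h`:
the inner product is `‖k‖²`, and Cauchy–Schwarz bounds it. -/
theorem norm_sum_smul_le_norm_matOp {n : ℕ} (x : Matrix (Fin n) (Fin n) (H →L[ℂ] H))
    (a b : EuclideanSpace ℂ (Fin n)) :
    ‖∑ i, ∑ j, (star (b i) * a j) • x i j‖ ≤ ‖matOp x‖ * (‖b‖ * ‖a‖) := by
  refine ContinuousLinearMap.opNorm_le_bound _ (by positivity) fun h => ?_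
  set k := (∑ i, ∑ j, (star (b i) * a j) • x i j) h with hk
  have hn : ∀ (a : EuclideanSpace ℂ (Fin n)) (h : H),
      ‖(WithLp.toLp 2 (fun i => a i • h) : PiLp 2 fun _ : Fin n => H)‖ = ‖a‖ * ‖h‖ := by
    intro a h
    rw [PiLp.norm_eq_of_L2, EuclideanSpace.norm_eq, ← Real.sqrt_sq (norm_nonneg h),
      ← Real.sqrt_mul (by positivity), Finset.sum_mul]
    simp [norm_smul, mul_pow]
  have hin : inner ℂ (WithLp.toLp 2 (fun i => b i • k) : PiLp 2 fun _ : Fin n => H)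
      (matOp x (WithLp.toLp 2 (fun i => a i • h))) = inner ℂ k k := by
    suffices ∀ k' : H, inner ℂ (WithLp.toLp 2 (fun i => b i • k') : PiLp 2 fun _ : Fin n => H)
        (matOp x (WithLp.toLp 2 (fun i => a i • h))) =
          inner ℂ k' ((∑ i, ∑ j, (star (b i) * a j) • x i j) h) from this k
    intro k'
    rw [PiLp.inner_apply, sum_apply, inner_sum]
    refine Finset.sum_congr rfl fun i _ => ?_
    rw [matOp_apply, sum_apply, inner_sum, inner_sum]
    refine Finset.sum_congr rfl fun j _ => ?_
    simp only [inner_smul_left, inner_smul_right, map_smul, smul_apply,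
      Complex.star_def]
    ring
  have hle := norm_inner_le_norm (𝕜 := ℂ)
    (WithLp.toLp 2 (fun i => b i • k) : PiLp 2 fun _ : Fin n => H)
    (matOp x (WithLp.toLp 2 (fun i => a i • h)))
  rw [hin, hn, inner_self_eq_norm_sq_to_K] at hle
  have h2 := (matOp x).le_opNorm (WithLp.toLp 2 (fun i => a i • h))
  rw [hn] at h2
  rcases (norm_nonneg k).eq_or_lt with h0 | h0
  · rw [← h0]
    positivity
  · refine le_of_mul_le_mul_left ?_ h0
    simp at hle
    nlinarith [mul_nonneg (norm_nonneg b) (norm_nonneg k)]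

theorem norm_matOp_one (T : H →L[ℂ] H) : ‖matOp (Matrix.of fun _ _ : Fin 1 => T)‖ = ‖T‖ := by
  refine le_antisymm ?_ ?_
  · have : (Matrix.of fun _ _ : Fin 1 => T) = Matrix.single 0 0 T := by
      ext i j : 2
      simp [Subsingleton.elim i 0, Subsingleton.elim j 0]
    rw [this]
    exact norm_matOp_single_le _ _ _
  · simpa [EuclideanSpace.norm_eq] using
      norm_sum_smul_le_norm_matOp (Matrix.of fun _ _ : Fin 1 => T)
        (WithLp.toLp 2 fun _ => 1) (WithLp.toLp 2 fun _ => 1)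

theorem norm_matOp_smul_le {n : ℕ} (c : ℂ) (x : Matrix (Fin n) (Fin n) (H →L[ℂ] H)) :
    ‖matOp (c • x)‖ ≤ ‖c‖ * ‖matOp x‖ := by
  refine ContinuousLinearMap.opNorm_le_bound _ (by positivity) fun ξ => ?_
  have : matOp (c • x) ξ = c • matOp x ξ := by
    ext i
    simp [matOp_apply, Finset.smul_sum]
  rw [this, norm_smul, mul_assoc]
  gcongr
  exact (matOp x).le_opNorm ξ

end MatOp

/-- The structure postulates almost nothing about `mnorm`; the norm estimates on `M_n(X)` are
transported from operators through this map. -/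
theorem exists_completeIsometry : ∃ (H : Type w) (_ : NormedAddCommGroup H)
    (_ : InnerProductSpace ℂ H) (T : X →ₗ[ℂ] (H →L[ℂ] H)), (∀ x, ‖T x‖ = ‖x‖) ∧
      ∀ n (x : Matrix (Fin n) (Fin n) X), ‖matOp (x.map T)‖ = S.mnorm n x := by
  obtain ⟨H, i₁, i₂, _, T, -, hT, -⟩ := S.exists_rep
  refine ⟨H, i₁, i₂, T, fun x => ?_, hT⟩
  rw [← S.mnorm_one, ← hT, ← norm_matOp_one]
  rfl

theorem mnorm_single_le {n : ℕ} (i j : Fin n) (x : X) : S.mnorm n (Matrix.single i j x) ≤ ‖x‖ := by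
  obtain ⟨H, _, _, T, hiso, hT⟩ := S.exists_completeIsometry
  rw [← hT, Matrix.map_single]
  exact (norm_matOp_single_le i j _).trans_eq (hiso x)

theorem mnorm_diagonal_le (n : ℕ) (x : X) :
    S.mnorm n (Matrix.diagonal fun _ => x) ≤ ‖x‖ := by
  obtain ⟨H, _, _, T, hiso, hT⟩ := S.exists_completeIsometry
  rw [← hT, Matrix.diagonal_map (map_zero T)]
  exact (norm_matOp_diagonal_le _).trans_eq (hiso x)

theorem norm_sum_smul_le {n : ℕ} (x : Matrix (Fin n) (Fin n) X) (a b : EuclideanSpace ℂ (Fin n)) :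
    ‖∑ i, ∑ j, (star (b i) * a j) • x i j‖ ≤ S.mnorm n x * (‖b‖ * ‖a‖) := by
  obtain ⟨H, _, _, T, hiso, hT⟩ := S.exists_completeIsometry
  rw [← hiso, ← hT]
  simpa using norm_sum_smul_le_norm_matOp (x.map T) a b

theorem mnorm_nonneg {n : ℕ} (x : Matrix (Fin n) (Fin n) X) : 0 ≤ S.mnorm n x := by
  obtain ⟨H, _, _, T, hiso, hT⟩ := S.exists_completeIsometry
  rw [← hT]
  exact ContinuousLinearMap.opNorm_nonneg _

theorem mnorm_smul_le {n : ℕ} (c : ℂ) (x : Matrix (Fin n) (Fin n) X) :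
    S.mnorm n (c • x) ≤ ‖c‖ * S.mnorm n x := by
  obtain ⟨H, _, _, T, hiso, hT⟩ := S.exists_completeIsometry
  rw [← hT, ← hT, Matrix.map_smul T c (fun a => map_smul T c a)]
  exact norm_matOp_smul_le c _

/-- Scalar functionals are automatically completely contractive: the form of `[φ(x_ij)]` at `a, b`
is `φ` applied to one element of norm at most `‖b‖ ‖a‖`. -/
theorem mem_dualBall_one {φ : StrongDual ℂ X} (hφ : ‖φ‖ ≤ 1) :
    (Matrix.of fun _ _ => φ) ∈ S.dualBall 1 := by
  intro p x hx
  rw [← norm_toEuclideanCLM_submatrix _ (Equiv.uniqueProd (Fin p) (Fin 1)).symm]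
  refine norm_toEuclideanCLM_le zero_le_one fun a b => ?_
  have h1 : ‖φ (∑ i, ∑ j, (star (b i) * a j) • x i j)‖ ≤ 1 * (‖b‖ * ‖a‖) := by
    refine (φ.le_opNorm _).trans ?_
    have := S.norm_sum_smul_le x a b
    have h3 : S.mnorm p x * (‖b‖ * ‖a‖) ≤ 1 * (‖b‖ * ‖a‖) := by gcongr
    gcongr
    linarith
  simpa using h1

theorem norm_sum_smul_le_of_mem_dualBall {m : ℕ} {φ : Matrix (Fin m) (Fin m) (StrongDual ℂ X)}
    (hφ : φ ∈ S.dualBall m) (a b : EuclideanSpace ℂ (Fin m)) :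
    ‖∑ i, ∑ j, (star (b i) * a j) • φ i j‖ ≤ ‖b‖ * ‖a‖ := by
  refine ContinuousLinearMap.opNorm_le_of_unit_norm (by positivity) fun x hx => ?_
  have h1 := hφ 1 (Matrix.of fun _ _ => x) (by rw [S.mnorm_one, hx])
  rw [← norm_toEuclideanCLM_submatrix _ (Equiv.prodUnique (Fin m) (Fin 1)).symm] at h1
  have h2 := norm_sum_le_norm_toEuclideanCLM (((Matrix.of fun a b : Fin m × Fin 1 =>
    φ a.1 b.1 ((Matrix.of fun _ _ : Fin 1 => x) a.2 b.2)).submatrix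
      (Equiv.prodUnique (Fin m) (Fin 1)).symm (Equiv.prodUnique (Fin m) (Fin 1)).symm)) a b
  have h3 := h2.trans (mul_le_mul_of_nonneg_right h1 (by positivity))
  simpa using h3

theorem bddBelow_bidualNorm (n : ℕ) (η : Matrix (Fin n) (Fin n) (StrongDual ℂ (StrongDual ℂ X))) :
    BddBelow {c : ℝ | 0 ≤ c ∧ ∀ (m : ℕ), ∀ φ ∈ S.dualBall m,
      ‖Matrix.toEuclideanCLM (n := Fin n × Fin m) (𝕜 := ℂ)
        (Matrix.of fun a b => η a.1 b.1 (φ a.2 b.2))‖ ≤ c} :=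
  ⟨0, fun _ hc => hc.1⟩

/-- The canonical map `M_n(X) → M_n(X'')` is contractive. -/
theorem bidualNorm_map_le {n : ℕ} (x : Matrix (Fin n) (Fin n) X) :
    S.bidualNorm n (x.map (NormedSpace.inclusionInDoubleDual ℂ X)) ≤ S.mnorm n x := by
  -- The slack `δ` permits normalizing `x` even when its norm is zero.
  refine le_of_forall_pos_le_add fun δ hδ => ?_
  have hpos : 0 < S.mnorm n x + δ := add_pos_of_nonneg_of_pos (S.mnorm_nonneg x) hδ
  refine csInf_le (S.bddBelow_bidualNorm n _) ⟨hpos.le, fun m φ hφ => ?_⟩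
  have h1 := hφ n ((((S.mnorm n x + δ)⁻¹ : ℝ) : ℂ) • x) (by
    refine (S.mnorm_smul_le _ _).trans ?_
    rw [Complex.norm_real, Real.norm_of_nonneg (by positivity),
      inv_mul_le_iff₀ hpos]
    linarith)
  rw [← norm_toEuclideanCLM_submatrix _ (Equiv.prodComm (Fin n) (Fin m))] at h1
  have h2 : ((Matrix.of fun a b : Fin m × Fin n =>
      φ a.1 b.1 (((((S.mnorm n x + δ)⁻¹ : ℝ) : ℂ) • x) a.2 b.2)).submatrix
        (Equiv.prodComm (Fin n) (Fin m)) (Equiv.prodComm (Fin n) (Fin m))) =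
      (((S.mnorm n x + δ)⁻¹ : ℝ) : ℂ) • (Matrix.of fun a b : Fin n × Fin m =>
        (x.map (NormedSpace.inclusionInDoubleDual ℂ X)) a.1 b.1 (φ a.2 b.2)) := by
    ext a b
    simp
  rw [h2, map_smul, norm_smul, Complex.norm_real, Real.norm_of_nonneg (by positivity),
    inv_mul_le_iff₀ hpos, mul_one] at h1
  exact h1

/-- Amplification does not increase the norm of a scalar functional, and matrices `φ` of size `1`
already attain it. This links the Banach norm, hence the distance, to the order unit norm. -/
theorem bidualNorm_one (η : StrongDual ℂ (StrongDual ℂ X)) :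
    S.bidualNorm 1 (Matrix.of fun _ _ => η) = ‖η‖ := by
  have hmem : ‖η‖ ∈ {c : ℝ | 0 ≤ c ∧ ∀ (m : ℕ), ∀ φ ∈ S.dualBall m,
      ‖Matrix.toEuclideanCLM (n := Fin 1 × Fin m) (𝕜 := ℂ)
        (Matrix.of fun a b => (Matrix.of fun _ _ : Fin 1 => η) a.1 b.1 (φ a.2 b.2))‖ ≤ c} := by
    refine ⟨norm_nonneg η, fun m φ hφ => ?_⟩
    rw [← norm_toEuclideanCLM_submatrix _ (Equiv.uniqueProd (Fin m) (Fin 1)).symm]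
    refine norm_toEuclideanCLM_le (norm_nonneg η) fun a b => ?_
    have := (η.le_opNorm (∑ i, ∑ j, (star (b i) * a j) • φ i j)).trans
      (mul_le_mul_of_nonneg_left (S.norm_sum_smul_le_of_mem_dualBall hφ a b) (norm_nonneg η))
    simpa using this
  refine le_antisymm (csInf_le (S.bddBelow_bidualNorm 1 _) hmem) (le_csInf ⟨_, hmem⟩ ?_)
  rintro c ⟨hc, hb⟩
  refine ContinuousLinearMap.opNorm_le_of_unit_norm hc fun φ hφ => ?_
  have h1 := hb 1 _ (S.mem_dualBall_one hφ.le)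
  have h2 := norm_sum_le_norm_toEuclideanCLM (Matrix.of fun _ _ : Fin 1 × Fin 1 => η φ)
    (WithLp.toLp 2 fun _ => 1) (WithLp.toLp 2 fun _ => 1)
  simp only [Matrix.of_apply] at h1
  simp [EuclideanSpace.norm_eq] at h2
  exact h2.trans h1

end OrderedOperatorSpace

end OrdOpSpace

end

/-! ### Weak* separation and matrices of functionals. -/

noncomputable section

namespace OrdOpSpace

/-- A point outside the closure of a convex cone is separated from the cone by a functional. -/
theorem exists_functional_separating {F : Type*} [TopologicalSpace F] [AddCommGroup F] [Module ℂ F]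
    [IsTopologicalAddGroup F] [ContinuousSMul ℂ F] [LocallyConvexSpace ℝ F] {K : Set F}
    (h0 : 0 ∈ K) (hadd : ∀ η ∈ K, ∀ ζ ∈ K, η + ζ ∈ K)
    (hsmul : ∀ r : ℝ, 0 ≤ r → ∀ η ∈ K, (r : ℂ) • η ∈ K) {ξ : F} (hξ : ξ ∉ closure K) :
    ∃ f : StrongDual ℂ F, (∀ η ∈ K, 0 ≤ (f η).re) ∧ (f ξ).re < 0 := by
  have : ContinuousSMul ℝ F := IsScalarTower.continuousSMul ℂ
  have hK : Convex ℝ K := fun η hη ζ hζ a b ha hb _ =>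
    hadd _ (hsmul a ha η hη) _ (hsmul b hb ζ hζ)
  obtain ⟨f, s, hfξ, hf⟩ := RCLike.geometric_hahn_banach_point_closed (𝕜 := ℂ) hK.closure
    isClosed_closure hξ
  have hs : s < 0 := by simpa using hf 0 (subset_closure h0)
  refine ⟨f, fun η hη => ?_, hfξ.trans hs⟩
  by_contra! hneg
  -- Scaling `η` to have real value exactly `s` contradicts the strict separation.
  have := hf _ (subset_closure (hsmul (s / (f η).re) (div_nonneg_of_nonpos hs.le hneg.le) η hη))
  rw [map_smul] at this
  simp [hneg.ne] at this

section WeakDual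

variable {E : Type u} [NormedAddCommGroup E] [NormedSpace ℂ E]

theorem exists_eval_of_weakDual_functional (g : StrongDual ℂ (WeakDual ℂ E)) :
    ∃ x : E, ∀ η : WeakDual ℂ E, g η = η x := by
  obtain ⟨x, hx⟩ := LinearMap.dualEmbedding_surjective (topDualPairing ℂ E) g
  exact ⟨x, fun η => (DFunLike.congr_fun hx η).symm⟩

theorem exists_matrix_of_weakDual_functional {n : ℕ}
    (f : StrongDual ℂ (Fin n → Fin n → WeakDual ℂ E)) :
    ∃ Φ : Matrix (Fin n) (Fin n) E, ∀ η, f η = ∑ i, ∑ j, η i j (Φ i j) := by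
  have key : ∀ i j, ∃ x : E, ∀ η : WeakDual ℂ E, f (Pi.single i (Pi.single j η)) = η x :=
    fun i j => exists_eval_of_weakDual_functional (f ∘L ContinuousLinearMap.single ℂ _ i ∘L
      ContinuousLinearMap.single ℂ (fun _ : Fin n => WeakDual ℂ E) j)
  choose Φ hΦ using key
  refine ⟨Φ, fun η => ?_⟩
  have hs : η = ∑ i, ∑ j, Pi.single i (Pi.single j (η i j)) := by
    funext k l
    simp [Finset.sum_apply, Pi.single_apply, ite_apply]
  conv_lhs => rw [hs]
  simp_rw [map_sum, hΦ]

/-- A matrix over a dual space outside the weak* closure of a convex cone is separated from the cone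
by a matrix over the predual. -/
theorem exists_matrix_separating {n : ℕ} {K : Set (Fin n → Fin n → WeakDual ℂ E)} (h0 : 0 ∈ K)
    (hadd : ∀ η ∈ K, ∀ ζ ∈ K, η + ζ ∈ K) (hsmul : ∀ r : ℝ, 0 ≤ r → ∀ η ∈ K, (r : ℂ) • η ∈ K)
    {ξ : Fin n → Fin n → WeakDual ℂ E} (hξ : ξ ∉ closure K) :
    ∃ Φ : Matrix (Fin n) (Fin n) E, (∀ η ∈ K, 0 ≤ (∑ i, ∑ j, η i j (Φ i j)).re) ∧
      (∑ i, ∑ j, ξ i j (Φ i j)).re < 0 := by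
  have h₁ : LocallyConvexSpace ℝ (WeakDual ℂ E) :=
    WeakBilin.locallyConvexSpace (B := topDualPairing ℂ E)
  have h₂ : LocallyConvexSpace ℝ (Fin n → WeakDual ℂ E) := Pi.locallyConvexSpace
  have h₃ : LocallyConvexSpace ℝ (Fin n → Fin n → WeakDual ℂ E) := Pi.locallyConvexSpace
  obtain ⟨f, hf, hfξ⟩ :=
    @exists_functional_separating (Fin n → Fin n → WeakDual ℂ E) _ _ _ _ _ h₃ K h0 hadd hsmul ξ hξ
  obtain ⟨Φ, hΦ⟩ := exists_matrix_of_weakDual_functional f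
  exact ⟨Φ, fun η hη => hΦ η ▸ hf η hη, hΦ ξ ▸ hfξ⟩

end WeakDual

section Pairing

variable {X : Type u} [NormedAddCommGroup X] [NormedSpace ℂ X]

/-- The weak* continuous functional on `M_n(X'')` given by a matrix of functionals on `X`. -/
def pairing {n : ℕ} (Φ : Matrix (Fin n) (Fin n) (StrongDual ℂ X)) :
    Matrix (Fin n) (Fin n) (StrongDual ℂ (StrongDual ℂ X)) →ₗ[ℂ] ℂ where
  toFun η := ∑ i, ∑ j, η i j (Φ i j)
  map_add' η ζ := by simp [Finset.sum_add_distrib]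
  map_smul' c η := by simp [Finset.mul_sum]

theorem pairing_apply {n : ℕ} (Φ : Matrix (Fin n) (Fin n) (StrongDual ℂ X))
    (η : Matrix (Fin n) (Fin n) (StrongDual ℂ (StrongDual ℂ X))) :
    pairing Φ η = ∑ i, ∑ j, η i j (Φ i j) := rfl

theorem inclusionInDoubleDual_injective :
    Function.Injective (NormedSpace.inclusionInDoubleDual ℂ X) :=
  (NormedSpace.inclusionInDoubleDualLi ℂ (E := X)).injective

variable [StarAddMonoid X] [StarModule ℂ X] [NormedStarGroup X]

theorem inclusionInDoubleDual_star (x : X) :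
    NormedSpace.inclusionInDoubleDual ℂ X (star x) =
      star (NormedSpace.inclusionInDoubleDual ℂ X x) := by
  ext φ
  simp [dualStar_apply]

/-- The selfadjoint part of a matrix of functionals. -/
def symmPart {n : ℕ} (Φ : Matrix (Fin n) (Fin n) (StrongDual ℂ X)) :
    Matrix (Fin n) (Fin n) (StrongDual ℂ X) :=
  Matrix.of fun i j => (2⁻¹ : ℂ) • (Φ i j + star (Φ j i))

theorem pairing_symmPart {n : ℕ} (Φ : Matrix (Fin n) (Fin n) (StrongDual ℂ X))
    (η : Matrix (Fin n) (Fin n) (StrongDual ℂ (StrongDual ℂ X))) :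
    pairing (symmPart Φ) η = 2⁻¹ * (pairing Φ η + star (pairing Φ η.conjTranspose)) := by
  simp only [pairing_apply, symmPart, Matrix.of_apply, map_smul, map_add, smul_eq_mul,
    Finset.sum_add_distrib, ← Finset.mul_sum, star_sum, Matrix.conjTranspose_apply, dualStar_apply,
    star_star]
  rw [Finset.sum_comm (f := fun i j => η i j (star (Φ j i)))]

theorem pairing_symmPart_conjTranspose {n : ℕ} (Φ : Matrix (Fin n) (Fin n) (StrongDual ℂ X))
    (η : Matrix (Fin n) (Fin n) (StrongDual ℂ (StrongDual ℂ X))) :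
    pairing (symmPart Φ) η.conjTranspose = star (pairing (symmPart Φ) η) := by
  have h : η.conjTranspose.conjTranspose = η := Matrix.conjTranspose_conjTranspose η
  rw [pairing_symmPart, pairing_symmPart, h]
  simp [add_comm]

/-- Symmetrizing keeps the separation on selfadjoint matrices and supplies the selfadjointness
needed for the order unit bound. -/
theorem pairing_symmPart_of_isHermitian {n : ℕ} (Φ : Matrix (Fin n) (Fin n) (StrongDual ℂ X))
    {η : Matrix (Fin n) (Fin n) (StrongDual ℂ (StrongDual ℂ X))} (hη : η.IsHermitian) :
    pairing (symmPart Φ) η = ((pairing Φ η).re : ℂ) := by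
  rw [pairing_symmPart, hη.eq, Complex.star_def, Complex.add_conj]
  push_cast
  ring

end Pairing

namespace OrderedOperatorSpace

variable {X : Type u} [NormedAddCommGroup X] [NormedSpace ℂ X] [StarAddMonoid X]
  [StarModule ℂ X] [NormedStarGroup X] (S : OrderedOperatorSpace.{u, w} X)

theorem map_mem_bidualCone {n : ℕ} {x : Matrix (Fin n) (Fin n) X} (hx : x ∈ S.cone n) :
    x.map (NormedSpace.inclusionInDoubleDual ℂ X) ∈ S.bidualCone n := by
  rw [bidualCone, Set.mem_ofPred_eq]
  exact subset_closure ⟨x, hx, rfl⟩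

/-- The pairing is weak* continuous, so nonnegativity passes to the closure. -/
theorem pairing_re_nonneg {n : ℕ} {Φ : Matrix (Fin n) (Fin n) (StrongDual ℂ X)}
    (hΦ : ∀ x ∈ S.cone n, 0 ≤ (pairing Φ (x.map (NormedSpace.inclusionInDoubleDual ℂ X))).re)
    {η : Matrix (Fin n) (Fin n) (StrongDual ℂ (StrongDual ℂ X))} (hη : η ∈ S.bidualCone n) :
    0 ≤ (pairing Φ η).re := by
  let g : Matrix (Fin n) (Fin n) (WeakDual ℂ (StrongDual ℂ X)) → ℝ :=
    fun ζ => (∑ i, ∑ j, ζ i j (Φ i j)).re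
  have hg : Continuous g := by
    refine Complex.continuous_re.comp (continuous_finsetSum _ fun i _ =>
      continuous_finsetSum _ fun j _ => ?_)
    exact (WeakDual.eval_continuous (Φ i j)).comp (continuous_apply_apply i j)
  have hsub := closure_minimal (t := {ζ | 0 ≤ g ζ}) (Set.image_subset_iff.2 fun x hx => hΦ x hx)
    (isClosed_le continuous_const hg)
  exact hsub hη

theorem exists_pairing_neg {n : ℕ}
    {η : Matrix (Fin n) (Fin n) (StrongDual ℂ (StrongDual ℂ X))} (hη : η ∉ S.bidualCone n) :
    ∃ Φ : Matrix (Fin n) (Fin n) (StrongDual ℂ X),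
      (∀ x ∈ S.cone n, 0 ≤ (pairing Φ (x.map (NormedSpace.inclusionInDoubleDual ℂ X))).re) ∧
      (pairing Φ η).re < 0 := by
  obtain ⟨Φ, h1, h2⟩ := exists_matrix_separating (K := (fun x : Matrix (Fin n) (Fin n) X =>
      (x.map (NormedSpace.inclusionInDoubleDual ℂ X)).map StrongDual.toWeakDual) '' S.cone n)
    (ξ := η.map StrongDual.toWeakDual)
    ⟨0, S.zero_mem n, by ext i j : 2; simp⟩
    (by
      rintro _ ⟨x, hx, rfl⟩ _ ⟨y, hy, rfl⟩
      refine ⟨x + y, S.add_mem n x hx y hy, ?_⟩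
      funext i j
      exact map_add (StrongDual.toWeakDual.toLinearMap ∘ₗ
        (NormedSpace.inclusionInDoubleDual ℂ X).toLinearMap) (x i j) (y i j))
    (by
      rintro r hr _ ⟨x, hx, rfl⟩
      refine ⟨(r : ℂ) • x, S.smul_mem n r hr x hx, ?_⟩
      funext i j
      exact map_smul (StrongDual.toWeakDual.toLinearMap ∘ₗ
        (NormedSpace.inclusionInDoubleDual ℂ X).toLinearMap) (r : ℂ) (x i j))
    hη
  exact ⟨Φ, fun x hx => h1 _ ⟨x, hx, rfl⟩, h2⟩

/-- A contractive functional on `M_n(X)` is the pairing with the matrix of the functionals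
`x ↦ φ (x ⊗ E_{ij})`. -/
theorem exists_pairing_eq {n : ℕ} {φ : Matrix (Fin n) (Fin n) X →ₗ[ℂ] ℂ}
    (hφ : ∀ x, ‖φ x‖ ≤ S.mnorm n x) : ∃ Φ : Matrix (Fin n) (Fin n) (StrongDual ℂ X),
      (∀ x, pairing Φ (x.map (NormedSpace.inclusionInDoubleDual ℂ X)) = φ x) ∧
      ∀ η, ‖pairing Φ (scalarMat 1 η)‖ ≤ ‖η‖ := by
  let Φ : Matrix (Fin n) (Fin n) (StrongDual ℂ X) := Matrix.of fun i j =>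
    (φ ∘ₗ Matrix.singleLinearMap ℂ i j).mkContinuous 1 fun x => by
      rw [one_mul]
      exact (hφ _).trans (S.mnorm_single_le i j x)
  have h1 : ∀ x, pairing Φ (x.map (NormedSpace.inclusionInDoubleDual ℂ X)) = φ x := by
    intro x
    conv_rhs => rw [Matrix.matrix_eq_sum_single x, map_sum φ]
    rw [pairing_apply]
    refine Finset.sum_congr rfl fun i _ => ?_
    rw [map_sum φ]
    rfl
  refine ⟨Φ, h1, fun η => ?_⟩
  have h2 : pairing Φ (scalarMat 1 η) = η (∑ i, Φ i i) := by
    rw [pairing_apply, map_sum]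
    refine Finset.sum_congr rfl fun i _ => ?_
    rw [Finset.sum_eq_single i]
    · simp [scalarMat_apply]
    · intro j _ hj
      simp [scalarMat_apply, Matrix.one_apply_ne' hj]
    · simp
  -- This functional is `φ` on the diagonal copy of `x`, whose matrix norm is at most `‖x‖`.
  have h3 : ‖∑ i, Φ i i‖ ≤ 1 := by
    refine ContinuousLinearMap.opNorm_le_bound _ zero_le_one fun x => ?_
    have : (∑ i, Φ i i) x = φ (Matrix.diagonal fun _ => x) := by
      rw [← h1, pairing_apply, sum_apply]
      refine Finset.sum_congr rfl fun i _ => ?_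
      rw [Finset.sum_eq_single i]
      · simp
      · intro j _ hj
        simp [Matrix.diagonal_apply_ne' _ hj]
      · simp
    rw [this, one_mul]
    exact (hφ _).trans (S.mnorm_diagonal_le n x)
  rw [h2]
  exact (η.le_opNorm _).trans (mul_le_of_le_one_right (norm_nonneg η) h3)

end OrderedOperatorSpace

end OrdOpSpace

end

/-! ### Comparison of the Werner cones with the bidual cones. -/

noncomputable section

namespace OrdOpSpace

namespace OrderedOperatorSpace

variable {X : Type u} [NormedAddCommGroup X] [NormedSpace ℂ X] [StarAddMonoid X]
  [StarModule ℂ X] [NormedStarGroup X] {S : OrderedOperatorSpace.{u, w} X}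
  {e : StrongDual ℂ (StrongDual ℂ X)}

theorem norm_eq_orderUnitNorm (he : IsUnitalOperatorSystem S.bidualNorm S.bidualCone e)
    (η : StrongDual ℂ (StrongDual ℂ X)) :
    ‖η‖ = orderUnitNorm S.bidualCone e (Matrix.of fun _ _ : Fin 1 => η) := by
  rw [← he.norm_eq, S.bidualNorm_one]

theorem norm_unit_le (he : IsUnitalOperatorSystem S.bidualNorm S.bidualCone e) : ‖e‖ ≤ 1 := by
  rw [norm_eq_orderUnitNorm he]
  exact he.orderUnitNorm_unit_le

/-- For selfadjoint `w ∈ M_n(X)`, one has `w + 1 ≥ 0` in `M_n(X'')` iff every positive contractive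
functional on `M_n(X)` is at least `-1` at `w`. -/
theorem map_add_unit_mem_bidualCone_iff
    (he : IsUnitalOperatorSystem S.bidualNorm S.bidualCone e) {n : ℕ}
    {w : Matrix (Fin n) (Fin n) X} (hw : w.IsHermitian) :
    w.map (NormedSpace.inclusionInDoubleDual ℂ X) + scalarMat 1 e ∈ S.bidualCone n ↔
      ∀ φ ∈ S.positiveContractive n, -1 ≤ (φ w).re := by
  constructor
  · rintro h φ ⟨hφ, hpos⟩
    obtain ⟨Φ, h1, h2⟩ := S.exists_pairing_eq hφ
    have h3 := S.pairing_re_nonneg (Φ := Φ)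
      (fun x hx => by rw [h1]; exact (Complex.nonneg_iff.1 (hpos x hx)).1) h
    rw [map_add, h1, Complex.add_re] at h3
    have h4 := (Complex.re_le_norm _).trans ((h2 e).trans (norm_unit_le he))
    linarith
  · intro h
    by_contra hmem
    obtain ⟨Φ, h1, h2⟩ := S.exists_pairing_neg hmem
    have hherm : (w.map (NormedSpace.inclusionInDoubleDual ℂ X)).IsHermitian :=
      hw.map _ inclusionInDoubleDual_star
    have hone := he.isHermitian _ _ (he.scalarMat_one_mem n)
    have hneg : (pairing (symmPart Φ)
        (w.map (NormedSpace.inclusionInDoubleDual ℂ X) + scalarMat 1 e)).re < 0 := by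
      rw [pairing_symmPart_of_isHermitian Φ (hherm.add hone)]
      exact h2
    have hpos : ∀ η ∈ S.bidualCone n, 0 ≤ (pairing (symmPart Φ) η).re := by
      intro η hη
      rw [pairing_symmPart_of_isHermitian Φ (he.isHermitian n η hη)]
      exact S.pairing_re_nonneg h1 hη
    have hbound := he.norm_apply_le (pairing (symmPart Φ)) hpos
      (pairing_symmPart_conjTranspose Φ)
    set s := (pairing (symmPart Φ) (scalarMat 1 e)).re with hs
    -- If the value at the unit were zero, the bound would make the functional vanish at `w + 1`,
    -- against the separation.
    have hs0 : 0 < s := by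
      refine lt_of_le_of_ne (hpos _ (he.scalarMat_one_mem n)) fun h0 => ?_
      have := hbound (w.map (NormedSpace.inclusionInDoubleDual ℂ X) + scalarMat 1 e)
      rw [← h0, zero_mul] at this
      have h5 := Complex.abs_re_le_norm (pairing (symmPart Φ)
        (w.map (NormedSpace.inclusionInDoubleDual ℂ X) + scalarMat 1 e))
      have h6 := abs_nonneg (pairing (symmPart Φ)
        (w.map (NormedSpace.inclusionInDoubleDual ℂ X) + scalarMat 1 e)).re
      rw [abs_of_neg hneg] at h5
      linarith
    let φ : Matrix (Fin n) (Fin n) X →ₗ[ℂ] ℂ := ((s⁻¹ : ℝ) : ℂ) •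
      (pairing (symmPart Φ) ∘ₗ (NormedSpace.inclusionInDoubleDual ℂ X).toLinearMap.mapMatrix)
    have hφ : ∀ x, φ x = ((s⁻¹ : ℝ) : ℂ) *
        pairing (symmPart Φ) (x.map (NormedSpace.inclusionInDoubleDual ℂ X)) := fun x => rfl
    have h7 := h φ ⟨fun x => ?_, fun x hx => ?_⟩
    · rw [hφ, Complex.re_ofReal_mul, ← div_eq_inv_mul, le_div_iff₀ hs0] at h7
      rw [map_add, Complex.add_re] at hneg
      linarith
    · rw [hφ, norm_mul, Complex.norm_real, Real.norm_of_nonneg (inv_nonneg.2 hs0.le),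
        inv_mul_le_iff₀ hs0]
      refine (hbound _).trans ?_
      gcongr
      rw [← he.norm_eq]
      exact S.bidualNorm_map_le x
    · have hx' := S.map_mem_bidualCone hx
      rw [hφ, pairing_symmPart_of_isHermitian Φ (he.isHermitian n _ hx'), ← Complex.ofReal_mul,
        Complex.zero_le_real]
      exact mul_nonneg (inv_nonneg.2 hs0.le) (S.pairing_re_nonneg h1 hx')

/-- The absence of a dominating element serves only to recover selfadjointness and `A ≥ 0` from
positivity in the bidual. -/
theorem mem_wernerCone_iff (he : IsUnitalOperatorSystem S.bidualNorm S.bidualCone e)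
    (hno : ¬ ∃ v : X, S.Dominates v e) {n : ℕ} (z : Matrix (Fin n) (Fin n) (X × ℂ)) :
    z ∈ S.wernerCone n ↔ z.map (addUnit (NormedSpace.inclusionInDoubleDual ℂ X).toLinearMap e) ∈
      S.bidualCone n := by
  suffices hkey : (z.map Prod.fst).IsHermitian → (z.map Prod.snd).PosSemidef →
      ((∀ ε : ℝ, 0 < ε → ∀ φ ∈ S.positiveContractive n, -1 ≤
        (φ (compress (CFC.sqrt (z.map Prod.snd + (ε : ℂ) • 1))⁻¹ (z.map Prod.fst))).re) ↔
          z.map (addUnit (NormedSpace.inclusionInDoubleDual ℂ X).toLinearMap e) ∈ S.bidualCone n) by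
    constructor
    · rintro ⟨h1, h2, h3⟩
      exact (hkey h1 h2).1 h3
    · intro h
      have hz := he.isHermitian_of_map_addUnit_mem inclusionInDoubleDual_injective
        inclusionInDoubleDual_star (fun v hv => hno ⟨v, hv⟩) h
      have h1 : (z.map Prod.fst).IsHermitian := hz.map _ fun _ => rfl
      have h2 : (z.map Prod.snd).PosSemidef :=
        he.posSemidef_of_mem (fun v hv => hno ⟨v, hv⟩) (hz.map _ fun _ => rfl) h
      exact ⟨h1, h2, (hkey h1 h2).2 h⟩
  intro h1 h2
  rw [map_addUnit]
  set v := z.map Prod.fst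
  set A := z.map Prod.snd
  -- With `B = A + ε` invertible, compressing by `B^{1/2}` and by its inverse exchanges `v + B ⊗ e`
  -- and `B^{-1/2} v B^{-1/2} + 1 ⊗ e`.
  have hε : ∀ ε : ℝ, 0 < ε → ((∀ φ ∈ S.positiveContractive n, -1 ≤
      (φ (compress (CFC.sqrt (A + (ε : ℂ) • 1))⁻¹ v)).re) ↔
        scalarMat ((ε : ℂ) • 1) e + (v.map (NormedSpace.inclusionInDoubleDual ℂ X) +
          scalarMat A e) ∈ S.bidualCone n) := by
    intro ε hε
    have hpd : (A + (ε : ℂ) • 1).PosDef :=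
      Matrix.PosDef.posSemidef_add h2 (Matrix.PosDef.one.smul (by simpa using hε))
    set B := A + (ε : ℂ) • (1 : Matrix (Fin n) (Fin n) ℂ) with hB
    have hBB : CFC.sqrt B * CFC.sqrt B = B := CFC.sqrt_mul_sqrt_self B hpd.posSemidef.nonneg
    have hBh : (CFC.sqrt B).conjTranspose = CFC.sqrt B :=
      (Matrix.nonneg_iff_posSemidef.1 (CFC.sqrt_nonneg B)).isHermitian
    have hdet : IsUnit (CFC.sqrt B).det := by
      have := (Matrix.isUnit_iff_isUnit_det B).1 hpd.isUnit
      rw [← hBB, Matrix.det_mul] at this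
      exact isUnit_of_mul_isUnit_left this
    have hherm : (compress (CFC.sqrt B)⁻¹ v).IsHermitian := by
      exact isHermitian_compress _ h1
    rw [← map_add_unit_mem_bidualCone_iff he hherm]
    have hsum : scalarMat ((ε : ℂ) • 1) e + (v.map (NormedSpace.inclusionInDoubleDual ℂ X) +
        scalarMat A e) = v.map (NormedSpace.inclusionInDoubleDual ℂ X) + scalarMat B e := by
      rw [hB, scalarMat_add]
      abel
    rw [hsum]
    have hBi : ((CFC.sqrt B)⁻¹).conjTranspose * B * (CFC.sqrt B)⁻¹ = 1 := by
      rw [Matrix.conjTranspose_nonsing_inv, hBh, Matrix.mul_assoc]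
      nth_rewrite 2 [← hBB]
      rw [Matrix.mul_assoc, Matrix.mul_nonsing_inv _ hdet, Matrix.mul_one,
        Matrix.nonsing_inv_mul _ hdet]
    constructor
    · intro h
      have := he.compress_mem n n (CFC.sqrt B) _ h
      rwa [compress_add, ← map_compress, compress_compress, Matrix.nonsing_inv_mul _ hdet,
        compress_one, compress_scalarMat, hBh, Matrix.mul_one, hBB] at this
    · intro h
      have := he.compress_mem n n (CFC.sqrt B)⁻¹ _ h
      rwa [compress_add, ← map_compress, compress_scalarMat, hBi] at this
  constructor
  · intro h
    exact he.archimedean n _ fun r hr => (hε r hr).1 (h r hr)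
  · intro h ε hpos
    refine (hε ε hpos).2 (he.add_mem n _ (he.scalarMat_mem ?_) _ h)
    exact Matrix.PosSemidef.one.smul (by simpa using hpos.le)

theorem wernerEqSpan_of_not_dominates
    (he : IsUnitalOperatorSystem S.bidualNorm S.bidualCone e)
    (hno : ¬ ∃ v : X, S.Dominates v e) : S.WernerEqSpan e := by
  have hinj : Function.Injective (addUnit (NormedSpace.inclusionInDoubleDual ℂ X).toLinearMap e) :=
    addUnit_injective inclusionInDoubleDual_injective
      (he.ne_unit_of_forall_notMem fun v hv => hno ⟨v, hv⟩)
  exact ⟨(LinearEquiv.ofInjective _ hinj).trans (LinearEquiv.ofEq _ _ (range_addUnit _ e)),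
    fun x => addUnit_inl _ e x, addUnit_unit _ e, fun n z => mem_wernerCone_iff he hno z,
    fun n z => (orderUnitNorm_map_addUnit inclusionInDoubleDual_star he.star_unit
      (fun n z => mem_wernerCone_iff he hno z) z).trans (he.norm_eq n _).symm⟩

theorem not_dominates_of_wernerEqSpan (h : S.WernerEqSpan e) : ¬ ∃ v : X, S.Dominates v e := by
  obtain ⟨Θ, h1, h2, h3, -⟩ := h
  rintro ⟨v, hv⟩
  have hΘ : (Θ (v, -1) : StrongDual ℂ (StrongDual ℂ X)) =
      NormedSpace.inclusionInDoubleDual ℂ X v - e := by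
    have hsub := map_sub ((spanUnit X e).subtype ∘ₗ Θ.toLinearMap) ((v, 0) : X × ℂ) (0, 1)
    have hv' : ((v, 0) : X × ℂ) - (0, 1) = (v, -1) := by simp
    rw [hv'] at hsub
    exact hsub.trans (congrArg₂ (· - ·) (h1 v) h2)
  have heq : (Matrix.of fun _ _ : Fin 1 => ((v, -1) : X × ℂ)).map
      (fun z => (Θ z : StrongDual ℂ (StrongDual ℂ X))) =
        Matrix.of fun _ _ => NormedSpace.inclusionInDoubleDual ℂ X v - e :=
    Matrix.ext fun _ _ => hΘ
  rw [Dominates, ← heq, ← h3] at hv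
  have := hv.2.1.diag_nonneg (i := 0)
  norm_num [Complex.nonneg_iff] at this

theorem infDist_unit_eq_one (he : IsUnitalOperatorSystem S.bidualNorm S.bidualCone e)
    (hno : ¬ ∃ v : X, S.Dominates v e) :
    Metric.infDist e (Set.range (NormedSpace.inclusionInDoubleDual ℂ X)) = 1 := by
  refine le_antisymm ?_ ?_
  · have h0 : (0 : StrongDual ℂ (StrongDual ℂ X)) ∈
        Set.range (NormedSpace.inclusionInDoubleDual ℂ X) := ⟨0, map_zero _⟩
    exact (Metric.infDist_le_dist_of_mem h0).trans ((dist_zero_right e).trans_le (norm_unit_le he))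
  · by_contra! hlt
    obtain ⟨_, ⟨x, rfl⟩, hx⟩ := (Metric.infDist_lt_iff (Set.range_nonempty _)).1 hlt
    have hx' : ‖e - NormedSpace.inclusionInDoubleDual ℂ X x‖ < 1 :=
      (dist_eq_norm e (NormedSpace.inclusionInDoubleDual ℂ X x)).symm.trans_lt hx
    rw [norm_eq_orderUnitNorm he] at hx'
    exact hno (he.exists_dominating_of_orderUnitNorm_lt inclusionInDoubleDual_star hx')

theorem not_dominates_of_infDist_eq_one
    (he : IsUnitalOperatorSystem S.bidualNorm S.bidualCone e)
    (h : Metric.infDist e (Set.range (NormedSpace.inclusionInDoubleDual ℂ X)) = 1) :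
    ¬ ∃ v : X, S.Dominates v e := by
  rintro ⟨v, hv⟩
  have hv' : (Matrix.of fun _ _ : Fin 1 =>
      (NormedSpace.inclusionInDoubleDual ℂ X).toLinearMap v - e) ∈ S.bidualCone 1 := hv
  obtain ⟨x, hx⟩ := he.exists_orderUnitNorm_lt_of_dominating hv'
  have hnorm : ‖e - NormedSpace.inclusionInDoubleDual ℂ X x‖ < 1 :=
    (norm_eq_orderUnitNorm he _).trans_lt hx
  have hdist : dist e (NormedSpace.inclusionInDoubleDual ℂ X x) < 1 :=
    (dist_eq_norm e (NormedSpace.inclusionInDoubleDual ℂ X x)).trans_lt hnorm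
  exact ((Metric.infDist_le_dist_of_mem (Set.mem_range_self x)).trans_lt hdist).ne h

end OrderedOperatorSpace

end OrdOpSpace

end

theorem lemma3p4 {X : Type u} [NormedAddCommGroup X] [NormedSpace ℂ X] [CompleteSpace X]
    [StarAddMonoid X] [StarModule ℂ X] [NormedStarGroup X]
    (S : OrdOpSpace.OrderedOperatorSpace.{u, w} X)
    (e : StrongDual ℂ (StrongDual ℂ X))
    (he : OrdOpSpace.IsUnitalOperatorSystem S.bidualNorm S.bidualCone e) :
    (S.WernerEqSpan e ↔ ¬ ∃ v : X, S.Dominates v e) ∧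
    (S.WernerEqSpan e ↔
      Metric.infDist e (Set.range (NormedSpace.inclusionInDoubleDual ℂ X)) = 1) := by
  open OrdOpSpace.OrderedOperatorSpace in
  exact ⟨⟨not_dominates_of_wernerEqSpan, wernerEqSpan_of_not_dominates he⟩,
    fun h => infDist_unit_eq_one he (not_dominates_of_wernerEqSpan h),
    fun h => wernerEqSpan_of_not_dominates he (not_dominates_of_infDist_eq_one he h)⟩
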